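/- Let $\mathcal X\subset\mathbb C$ be a finite constellation with $|\mathcal X|\ge 2$, put $M=\log_2|\mathcal X|$, and assume $\sum_{x\in\mathcal X}|x|^2=2^M$. For $\rho\ge 0$ let $$I_{\mathcal X}(\rho)=M-\mathbb E_{X,Z}\Big[\log_2\Big(\sum_{x'\in\mathcal X}e^{-|\sqrt\rho(X-x')+Z|^2+|Z|^2}\Big)\Big]$$ be the input-output mutual information of the AWGN channel at SNR $\rho$, where $X$ is uniform on $\mathcal X$ and $Z\sim\mathcal N_{\mathbb C}(0,1)$ is independent of $X$. Let $B\ge 1$ be an integer, $m>0$, and let the power fading gains $\gamma_1,\dots,\gamma_B$ be independent, each with the Nakagami-$m$ power density $\frac{m^m\gamma^{m-1}}{\Gamma(m)}e^{-m\gamma}$ for $\gamma\ge 0$ (and $0$ otherwise). For $\beta>0$ and $P>0$ the truncated water-filling allocation with truncation parameter $\beta$ is $$p^{\rm tw}_b(\boldsymbol\gamma)=\begin{cases}\beta/\gamma_b,&\text{if }\sum_{c=1}^B\beta/\gamma_c\le BP,\\ \min\{\beta/\gamma_b,(\eta-1/\gamma_b)_+\},&\text{otherwise,}\end{cases}$$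 where $\eta$ is chosen such that $\sum_{b=1}^B\min\{\beta/\gamma_b,(\eta-1/\gamma_b)_+\}=BP$. Its outage probability at rate $R$ is $$P_{\rm out}(\mathbf p^{\rm tw},R)=\Pr\Big(\frac1B\sum_{b=1}^B I_{\mathcal X}(p^{\rm tw}_b\gamma_b)<R\Big).$$ Put $$d_\beta(R)=1+\Big\lfloor B\Big(1-\frac{R}{I_{\mathcal X}(\beta)}\Big)\Big\rfloor,\qquad d_B(R)=1+\Big\lfloor B\Big(1-\frac RM\Big)\Big\rfloor$$ (the latter is the Singleton bound). 1. For every $\beta>0$ and every $R>0$ there is a constant $\mathcal K_\beta>0$, not depending on $P$, such that $P_{\rm out}(\mathbf p^{\rm tw},R)\le\mathcal K_\beta P^{-m\,d_\beta(R)}$ for all sufficiently large $P$. 2. Let $0<R<M$ be such that $B(1-R/M)$ is not an integer. Then there is exactly one $\beta_R\ge 0$ with $$I_{\mathcal X}(\beta_R)=\frac{BR}{B-\lfloor B(1-R/M)\rfloor},$$ it is positive, and for every $\beta\ge\beta_R$ truncated water-filling achieves the full Singleton-bound diversity: $d_\beta(R)=d_B(R)$, there are constants $c,K>0$ with $cP^{-m\,d_B(R)}\le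 P_{\rm out}(\mathbf p^{\rm tw},R)\le KP^{-m\,d_B(R)}$ for all sufficiently large $P$, and hence $$\lim_{P\to\infty}\frac{-\log P_{\rm out}(\mathbf p^{\rm tw},R)}{\log P}=m\,d_B(R).$$ -/

import Mathlib

open MeasureTheory ProbabilityTheory Filter Topology
open scoped BigOperators

namespace BlockFading

/-- The circularly symmetric complex Gaussian law `𝒩_ℂ(0, 1)`, with density `π⁻¹ exp (-|z|²)`. -/
noncomputable def stdComplexGaussian : Measure ℂ :=
  (volume : Measure ℂ).withDensity fun z => ENNReal.ofReal (Real.exp (-‖z‖ ^ 2) / Real.pi)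

/-- `M = log₂ |𝒳|`, the number of bits per symbol of the constellation `X`. -/
noncomputable def bits (X : Finset ℂ) : ℝ := Real.logb 2 X.card

/-- `I_𝒳(ρ)`: the input-output mutual information (in bits) of the AWGN channel at SNR `ρ` whose
input `X` is uniform on the constellation,
`M - 𝔼_{X,Z} [log₂ (∑_{x'} exp (-|√ρ (X - x') + Z|² + |Z|²))]`. -/
noncomputable def mutualInfo (X : Finset ℂ) (ρ : ℝ) : ℝ :=
  bits X - (X.card : ℝ)⁻¹ * ∑ x ∈ X, ∫ z, Real.logb 2
    (∑ x' ∈ X, Real.exp (-‖(Real.sqrt ρ : ℂ) * (x - x') + z‖ ^ 2 + ‖z‖ ^ 2)) ∂stdComplexGaussian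

/-- The instantaneous mutual information `(1 / B) ∑_b I_𝒳(p_b γ_b)`. -/
noncomputable def blockMutualInfo (X : Finset ℂ) {B : ℕ} (p γ : Fin B → ℝ) : ℝ :=
  (B : ℝ)⁻¹ * ∑ b, mutualInfo X (p b * γ b)

/-- The probability that the instantaneous mutual information is below `R`, for random power
fading gains `γ` and the power allocation rule `p`. -/
noncomputable def outageProb {Ω : Type*} [MeasurableSpace Ω] (μ : Measure Ω) (X : Finset ℂ)
    {B : ℕ} (γ : Fin B → Ω → ℝ) (p : (Fin B → ℝ) → Fin B → ℝ) (R : ℝ) : ℝ :=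
  μ.real {ω | blockMutualInfo X (p fun b => γ b ω) (fun b => γ b ω) < R}

/-- `min {β / g, (η - 1 / g)₊}`: the power given to a block of gain `g` at water level `η`. -/
noncomputable def twPower (β η g : ℝ) : ℝ := min (β / g) (max (η - 1 / g) 0)

/-- If giving `β / γ_b` to every block exceeds the power budget, some water level meets the budget
with equality. -/
theorem exists_waterLevel {B : ℕ} {β P : ℝ} {γ : Fin B → ℝ} (hβ : 0 < β) (hP : 0 ≤ P)
    (hγ : ∀ b, 0 < γ b) (h : ¬ ∑ b, β / γ b ≤ B * P) :
    ∃ η, ∑ b, twPower β η (γ b) = B * P := by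
  have hc : Continuous fun η => ∑ b, twPower β η (γ b) := by
    unfold twPower
    fun_prop
  have h0 : ∑ b, twPower β 0 (γ b) = 0 := by
    refine Finset.sum_eq_zero fun b _ => ?_
    have h1 : 0 < 1 / γ b := one_div_pos.2 (hγ b)
    have h2 : 0 < β / γ b := div_pos hβ (hγ b)
    rw [twPower, max_eq_right (by linarith), min_eq_right h2.le]
  have h1 : ∑ b, twPower β (∑ c, (β + 1) / γ c) (γ b) = ∑ b, β / γ b := by
    refine Finset.sum_congr rfl fun b _ => ?_
    have h2 : (β + 1) / γ b ≤ ∑ c, (β + 1) / γ c :=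
      Finset.single_le_sum (f := fun c => (β + 1) / γ c)
        (fun c _ => (div_pos (by linarith) (hγ c)).le) (Finset.mem_univ b)
    rw [add_div] at h2
    exact min_eq_left (le_max_of_le_left (by linarith))
  have hmem : (B * P : ℝ) ∈ Set.Icc (∑ b, twPower β 0 (γ b))
      (∑ b, twPower β (∑ c, (β + 1) / γ c) (γ b)) := by
    rw [h0, h1]
    exact ⟨by positivity, (not_le.1 h).le⟩
  obtain ⟨η, hη⟩ := mem_range_of_exists_le_of_exists_ge hc ⟨0, hmem.1⟩ ⟨_, hmem.2⟩
  exact ⟨η, hη⟩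

/-- Truncated water-filling with truncation parameter `β` and power budget `B * P`. The water level
is chosen so that the budget is met with equality (it exists by `exists_waterLevel`). -/
noncomputable def twAlloc (β P : ℝ) {B : ℕ} (γ : Fin B → ℝ) (b : Fin B) : ℝ :=
  open Classical in
  if ∑ c, β / γ c ≤ B * P then β / γ b
  else twPower β (Classical.epsilon fun η => ∑ c, twPower β η (γ c) = B * P) (γ b)

/-- `d_β(R) = 1 + ⌊B (1 - R / I_𝒳(β))⌋`. -/
noncomputable def twDiversity (X : Finset ℂ) (B : ℕ) (β R : ℝ) : ℤ :=
  1 + ⌊(B : ℝ) * (1 - R / mutualInfo X β)⌋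

/-- The Singleton bound `d_B(R) = 1 + ⌊B (1 - R / M)⌋`. -/
noncomputable def singletonBound (X : Finset ℂ) (B : ℕ) (R : ℝ) : ℤ :=
  1 + ⌊(B : ℝ) * (1 - R / bits X)⌋

/-- `B R / (B - ⌊B (1 - R / M)⌋)`. -/
noncomputable def rateThreshold (X : Finset ℂ) (B : ℕ) (R : ℝ) : ℝ :=
  B * R / (B - ⌊(B : ℝ) * (1 - R / bits X)⌋)

/-- `β_R = I_𝒳⁻¹ (B R / (B - ⌊B (1 - R / M)⌋))`, the inverse being that of `I_𝒳` on `[0, ∞)`. -/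
noncomputable def betaThreshold (X : Finset ℂ) (B : ℕ) (R : ℝ) : ℝ :=
  Function.invFunOn (mutualInfo X) (Set.Ici 0) (rateThreshold X B R)

end BlockFading

/-! The outage analysis rests on two facts about the allocation. A block with `γ_b ≥ (β + 1) / P`
gets exactly the SNR `β` (`twAlloc_mul_eq`), so an outage forces at least `d_β(R)` gains below `(β +
1) / P` (`twDiversity_le_card`). The gamma density behaves like `γ ^ (m - 1)` at zero, so each such
event has probability `O(P ^ (-m))`; independence and a union bound over sets of blocks give the
upper bound. Conversely no block gets more than `B * P`. If `d_B(R)` gains are below `ε / (B * P)`,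
those blocks carry almost no information and the others at most `M` each, which is too little for
rate `R` (`blockMutualInfo_lt`). This has probability at least a constant times `P ^ (-m d_B(R))`.
The threshold `β_R` exists and is unique because `I_𝒳` is continuous, vanishes at `0`, tends to `M`
and is strictly increasing. For the last point, an observation at amplitude `r` with `r² = s² + t²`
is equivalent to two independent ones at amplitudes `s` and `t`. The second multiplies the
likelihood sum by a nonconstant positive factor of mean `1`, whose logarithm has negative mean since
`log u < u - 1` for `u ≠ 1` (`equivocation_lt`). -/

namespace BlockFading

/-! ### The standard complex Gaussian law -/

theorem measurable_gaussianDensity :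
    Measurable fun z : ℂ => ENNReal.ofReal (Real.exp (-‖z‖ ^ 2) / Real.pi) := by
  fun_prop

theorem integrable_stdComplexGaussian_iff {E : Type*} [NormedAddCommGroup E] [NormedSpace ℝ E]
    {f : ℂ → E} :
    Integrable f stdComplexGaussian ↔
      Integrable (fun z : ℂ => (Real.exp (-‖z‖ ^ 2) / Real.pi) • f z) := by
  rw [stdComplexGaussian, integrable_withDensity_iff_integrable_smul'
    measurable_gaussianDensity (by simp)]
  refine integrable_congr (ae_of_all _ fun z => ?_)
  simp only
  rw [ENNReal.toReal_ofReal (by positivity)]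

theorem integral_stdComplexGaussian {E : Type*} [NormedAddCommGroup E] [NormedSpace ℝ E]
    (f : ℂ → E) :
    ∫ z, f z ∂stdComplexGaussian = ∫ z : ℂ, (Real.exp (-‖z‖ ^ 2) / Real.pi) • f z := by
  rw [stdComplexGaussian, integral_withDensity_eq_integral_toReal_smul
    measurable_gaussianDensity (by simp)]
  refine integral_congr_ae (ae_of_all _ fun z => ?_)
  simp only
  rw [ENNReal.toReal_ofReal (by positivity)]

theorem gaussianDensity_smul_cexp (a z : ℂ) :
    (Real.exp (-‖z‖ ^ 2) / Real.pi) • Complex.exp a =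
      (Real.pi : ℂ)⁻¹ * Complex.exp (-1 * ‖z‖ ^ 2 + a) := by
  rw [Complex.real_smul, Complex.exp_add]
  push_cast
  ring_nf

theorem integrable_cexp_inner (c w : ℂ) :
    Integrable (fun z : ℂ => Complex.exp (c * (inner ℝ w z : ℝ))) stdComplexGaussian := by
  rw [integrable_stdComplexGaussian_iff]
  simp_rw [gaussianDensity_smul_cexp]
  exact (GaussianFourier.integrable_cexp_neg_mul_sq_norm_add (b := 1) (by simp) c w).const_mul _

/-- A complex `c` covers three uses: total mass (`c = 0`), real exponential moments (`c = 1`) and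
characteristic functions (`c` imaginary). -/
theorem integral_cexp_inner (c w : ℂ) :
    ∫ z : ℂ, Complex.exp (c * (inner ℝ w z : ℝ)) ∂stdComplexGaussian =
      Complex.exp (c ^ 2 * ‖w‖ ^ 2 / 4) := by
  rw [integral_stdComplexGaussian]
  simp_rw [gaussianDensity_smul_cexp]
  rw [integral_const_mul, GaussianFourier.integral_cexp_neg_mul_sq_norm_add (b := 1) (by simp) c w]
  have : (Real.pi : ℂ) ≠ 0 := by exact_mod_cast Real.pi_ne_zero
  simp [this]

instance : IsProbabilityMeasure stdComplexGaussian := by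
  have h1 := integrable_cexp_inner 0 0
  have h2 := integral_cexp_inner 0 0
  simp only [zero_mul, Complex.exp_zero] at h1 h2
  have : IsFiniteMeasure stdComplexGaussian := by
    simpa [integrable_const_iff] using h1
  rw [integral_const] at h2
  simp at h2
  exact ⟨by simpa [Measure.real] using congrArg ENNReal.ofReal (by exact_mod_cast h2 :
    stdComplexGaussian.real Set.univ = 1)⟩

/-- Full support lets a strict inequality at one point between continuous functions pass to their
integrals. -/
instance : Measure.IsOpenPosMeasure stdComplexGaussian := by
  have h : (volume : Measure ℂ) ≪ stdComplexGaussian := by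
    refine withDensity_absolutelyContinuous' measurable_gaussianDensity.aemeasurable
      (ae_of_all _ fun z => ?_)
    simp only [ne_eq, ENNReal.ofReal_eq_zero, not_le]
    positivity
  exact h.isOpenPosMeasure

theorem integrable_rexp_inner (w : ℂ) :
    Integrable (fun z : ℂ => Real.exp (inner ℝ w z)) stdComplexGaussian := by
  refine (integrable_cexp_inner 1 w).re.congr (ae_of_all _ fun z => ?_)
  simp only [one_mul]
  exact Complex.exp_ofReal_re _

theorem integral_rexp_inner (w : ℂ) :
    ∫ z : ℂ, Real.exp (inner ℝ w z) ∂stdComplexGaussian = Real.exp (‖w‖ ^ 2 / 4) := by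
  have h := integral_cexp_inner 1 w
  rw [← Complex.ofReal_inj, ← integral_complex_ofReal]
  push_cast
  simpa using h

theorem integrable_norm_sq : Integrable (fun z : ℂ => ‖z‖ ^ 2) stdComplexGaussian := by
  rw [integrable_stdComplexGaussian_iff]
  have h : Integrable fun z : ℂ => Real.exp (-(1 / 2) * ‖z‖ ^ 2) := by
    have := (GaussianFourier.integrable_cexp_neg_mul_sq_norm_add (b := 1 / 2) (by norm_num) 0
      (0 : ℂ)).re
    refine this.congr (ae_of_all _ fun z => ?_)
    simp only [zero_mul, add_zero]
    rw [← Complex.exp_ofReal_re]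
    simp
  refine (h.const_mul 2).mono' (by fun_prop) (ae_of_all _ fun z => ?_)
  -- With `u = ‖z‖² / 2`, the bound `u ≤ exp u` absorbs the square into half of the Gaussian decay.
  have h1 := Real.add_one_le_exp (‖z‖ ^ 2 / 2)
  have h2 : Real.exp (-‖z‖ ^ 2) / Real.pi ≤ Real.exp (-‖z‖ ^ 2) :=
    div_le_self (Real.exp_nonneg _) (by linarith [Real.pi_gt_three])
  have h3 : Real.exp (-(1 / 2) * ‖z‖ ^ 2) = Real.exp (-‖z‖ ^ 2) * Real.exp (‖z‖ ^ 2 / 2) := by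
    rw [← Real.exp_add]; ring_nf
  rw [smul_eq_mul, Real.norm_of_nonneg (by positivity), h3]
  calc _ ≤ Real.exp (-‖z‖ ^ 2) * (2 * Real.exp (‖z‖ ^ 2 / 2)) := by gcongr; linarith
    _ = _ := by ring

/-- A weighted sum of two independent standard complex Gaussians is a scaled standard one. -/
theorem map_add_mul_prod_stdComplexGaussian {s t r : ℝ} (h : s ^ 2 + t ^ 2 = r ^ 2) :
    (stdComplexGaussian.prod stdComplexGaussian).map (fun p : ℂ × ℂ => s • p.1 + t • p.2) =
      stdComplexGaussian.map fun z => r • z := by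
  have hm1 : Measurable fun p : ℂ × ℂ => s • p.1 + t • p.2 := by fun_prop
  have hm2 : Measurable fun z : ℂ => r • z := by fun_prop
  have := Measure.isProbabilityMeasure_map (μ := stdComplexGaussian.prod stdComplexGaussian)
    hm1.aemeasurable
  have := Measure.isProbabilityMeasure_map (μ := stdComplexGaussian) hm2.aemeasurable
  refine Measure.ext_of_charFun (funext fun u => ?_)
  have key (a : ℝ) : ∫ z : ℂ, Complex.exp ((inner ℝ (a • z) u : ℝ) * Complex.I)
      ∂stdComplexGaussian = Complex.exp (-(a ^ 2 * ‖u‖ ^ 2 / 4)) := by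
    have := integral_cexp_inner (a * Complex.I) u
    rw [mul_pow, Complex.I_sq] at this
    convert this using 3 with z
    · rw [real_inner_comm, real_inner_smul_right]; push_cast; ring_nf
    · ring_nf
  rw [charFun_apply, charFun_apply, integral_map hm1.aemeasurable (by fun_prop),
    integral_map hm2.aemeasurable (by fun_prop), key]
  have h' : (s : ℂ) ^ 2 + (t : ℂ) ^ 2 = (r : ℂ) ^ 2 := by exact_mod_cast h
  simp_rw [inner_add_left, Complex.ofReal_add, add_mul, Complex.exp_add]
  rw [integral_prod_mul (fun z : ℂ => Complex.exp ((inner ℝ (s • z) u : ℝ) * Complex.I))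
    (fun z : ℂ => Complex.exp ((inner ℝ (t • z) u : ℝ) * Complex.I)), key, key,
    ← Complex.exp_add, ← h']
  ring_nf

/-! ### Likelihood ratios -/

/-- The sum over `x'` of the likelihood ratios of `x'` against `x` at the output `t x + z`. -/
noncomputable def likelihoodSum (X : Finset ℂ) (x : ℂ) (t : ℝ) (z : ℂ) : ℝ :=
  ∑ x' ∈ X, Real.exp (-‖(t : ℂ) * (x - x') + z‖ ^ 2 + ‖z‖ ^ 2)

/-- The equivocation (in nats) of the input, given that it is `x`. -/
noncomputable def equivocation (X : Finset ℂ) (x : ℂ) (t : ℝ) : ℝ :=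
  ∫ z, Real.log (likelihoodSum X x t z) ∂stdComplexGaussian

theorem mutualInfo_eq (X : Finset ℂ) (ρ : ℝ) :
    mutualInfo X ρ =
      bits X - (X.card : ℝ)⁻¹ * ∑ x ∈ X, equivocation X x (Real.sqrt ρ) / Real.log 2 := by
  simp only [mutualInfo, equivocation, likelihoodSum, Real.logb, integral_div]

section Information

variable {X : Finset ℂ} {x : ℂ}

theorem one_le_likelihoodSum (hx : x ∈ X) (t : ℝ) (z : ℂ) : 1 ≤ likelihoodSum X x t z := by
  have := Finset.single_le_sum
    (f := fun x' => Real.exp (-‖(t : ℂ) * (x - x') + z‖ ^ 2 + ‖z‖ ^ 2))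
    (fun _ _ => (Real.exp_pos _).le) hx
  simpa [likelihoodSum] using this

theorem likelihoodSum_le (X : Finset ℂ) (x : ℂ) (t : ℝ) (z : ℂ) :
    likelihoodSum X x t z ≤ X.card * Real.exp (‖z‖ ^ 2) := by
  rw [← nsmul_eq_mul]
  refine Finset.sum_le_card_nsmul _ _ _ fun x' _ => Real.exp_le_exp.2 ?_
  nlinarith [sq_nonneg ‖(t : ℂ) * (x - x') + z‖]

theorem continuous_log_likelihoodSum {Y : Type*} [TopologicalSpace Y] (hx : x ∈ X) {f : Y → ℝ}
    {g : Y → ℂ} (hf : Continuous f) (hg : Continuous g) :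
    Continuous fun y => Real.log (likelihoodSum X x (f y) (g y)) := by
  refine Continuous.log ?_ fun y => (zero_lt_one.trans_le (one_le_likelihoodSum hx _ _)).ne'
  unfold likelihoodSum
  fun_prop

theorem log_likelihoodSum_nonneg (hx : x ∈ X) (t : ℝ) (z : ℂ) :
    0 ≤ Real.log (likelihoodSum X x t z) :=
  Real.log_nonneg (one_le_likelihoodSum hx t z)

/-- The bound does not involve `t`, so it dominates both for continuity in `t` and for the limit `t
→ ∞`. -/
theorem norm_log_likelihoodSum_le (hx : x ∈ X) (t : ℝ) (z : ℂ) :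
    ‖Real.log (likelihoodSum X x t z)‖ ≤ Real.log X.card + ‖z‖ ^ 2 := by
  have hc : (0 : ℝ) < X.card := by exact_mod_cast Finset.card_pos.2 ⟨x, hx⟩
  rw [Real.norm_of_nonneg (log_likelihoodSum_nonneg hx t z),
    ← Real.log_exp (‖z‖ ^ 2), ← Real.log_mul hc.ne' (Real.exp_pos _).ne']
  exact Real.log_le_log (zero_lt_one.trans_le (one_le_likelihoodSum hx t z))
    (likelihoodSum_le X x t z)

theorem integrable_log_card_add_norm_sq (X : Finset ℂ) :
    Integrable (fun z : ℂ => Real.log X.card + ‖z‖ ^ 2) stdComplexGaussian :=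
  (integrable_const _).add integrable_norm_sq

theorem integrable_log_likelihoodSum (hx : x ∈ X) (t : ℝ) :
    Integrable (fun z => Real.log (likelihoodSum X x t z)) stdComplexGaussian :=
  (integrable_log_card_add_norm_sq X).mono'
    (continuous_log_likelihoodSum hx continuous_const continuous_id).aestronglyMeasurable
    (ae_of_all _ (norm_log_likelihoodSum_le hx t))

theorem equivocation_nonneg (hx : x ∈ X) (t : ℝ) : 0 ≤ equivocation X x t :=
  integral_nonneg (log_likelihoodSum_nonneg hx t)

theorem equivocation_zero (X : Finset ℂ) (x : ℂ) : equivocation X x 0 = Real.log X.card := by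
  simp [equivocation, likelihoodSum]

theorem continuous_equivocation (hx : x ∈ X) : Continuous (equivocation X x) := by
  refine continuous_of_dominated (μ := stdComplexGaussian)
    (F := fun t z => Real.log (likelihoodSum X x t z))
    (bound := fun z => Real.log X.card + ‖z‖ ^ 2) (fun t => ?_) (fun t => ?_) ?_ ?_
  · exact (integrable_log_likelihoodSum hx t).aestronglyMeasurable
  · exact ae_of_all _ (norm_log_likelihoodSum_le hx t)
  · exact integrable_log_card_add_norm_sq X
  · exact ae_of_all _ fun z => continuous_log_likelihoodSum hx continuous_id continuous_const

theorem tendsto_likelihoodSum_atTop (hx : x ∈ X) (z : ℂ) :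
    Tendsto (fun t => likelihoodSum X x t z) atTop (𝓝 1) := by
  have h1 : (1 : ℝ) = ∑ x' ∈ X, if x' = x then 1 else 0 := by simp [hx]
  rw [h1]
  refine tendsto_finsetSum _ fun x' _ => ?_
  split_ifs with h
  · simp [h]
  · have h2 : 0 < ‖x - x'‖ := norm_pos_iff.2 (sub_ne_zero.2 (Ne.symm h))
    refine Real.tendsto_exp_atBot.comp (tendsto_atBot_add_const_right _ _ ?_)
    refine tendsto_neg_atTop_atBot.comp ((tendsto_pow_atTop two_ne_zero).comp ?_)
    -- By the triangle inequality the distance to a wrong point grows at least linearly in `t`.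
    refine tendsto_atTop_mono (f := fun t : ℝ => t * ‖x - x'‖ + -‖z‖) (fun t => ?_)
      (tendsto_atTop_add_const_right _ _ (tendsto_id.atTop_mul_const h2))
    have h3 := norm_sub_le ((t : ℂ) * (x - x') + z) z
    rw [add_sub_cancel_right, norm_mul, Complex.norm_real, Real.norm_eq_abs] at h3
    nlinarith [le_abs_self t]

theorem tendsto_equivocation_atTop (hx : x ∈ X) :
    Tendsto (equivocation X x) atTop (𝓝 0) := by
  have h : Tendsto (fun t => ∫ z, Real.log (likelihoodSum X x t z) ∂stdComplexGaussian) atTop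
      (𝓝 (∫ _, (0 : ℝ) ∂stdComplexGaussian)) := by
    refine tendsto_integral_filter_of_dominated_convergence _
      (Eventually.of_forall fun t => (integrable_log_likelihoodSum hx t).aestronglyMeasurable)
      (Eventually.of_forall fun t => ae_of_all _ (norm_log_likelihoodSum_le hx t))
      (integrable_log_card_add_norm_sq X) (ae_of_all _ fun z => ?_)
    simpa using (tendsto_likelihoodSum_atTop hx z).log one_ne_zero
  rw [integral_zero] at h
  exact h

/-! ### Strict monotonicity of the mutual information -/

/-- The likelihood ratio, at the output `t x + z`, of the input `x - d` against the input `x`. -/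
noncomputable def likelihoodRatio (t : ℝ) (d z : ℂ) : ℝ :=
  Real.exp (-(t ^ 2 * ‖d‖ ^ 2 + 2 * t * inner ℝ d z))

theorem likelihoodRatio_pos (t : ℝ) (d z : ℂ) : 0 < likelihoodRatio t d z := Real.exp_pos _

theorem continuous_likelihoodRatio (t : ℝ) (d : ℂ) : Continuous (likelihoodRatio t d) := by
  unfold likelihoodRatio
  fun_prop

theorem likelihoodSum_eq (X : Finset ℂ) (x : ℂ) (t : ℝ) (z : ℂ) :
    likelihoodSum X x t z = ∑ x' ∈ X, likelihoodRatio t (x - x') z := by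
  refine Finset.sum_congr rfl fun x' _ => congrArg Real.exp ?_
  have h : (t : ℂ) * (x - x') = t • (x - x') := by simp
  rw [h, norm_add_sq_real, norm_smul, real_inner_smul_left, mul_pow, Real.norm_eq_abs, sq_abs]
  ring

theorem likelihoodRatio_eq (t : ℝ) (d z : ℂ) :
    likelihoodRatio t d z = Real.exp (-(t ^ 2 * ‖d‖ ^ 2)) * Real.exp (inner ℝ (-(2 * t) • d) z) := by
  rw [likelihoodRatio, ← Real.exp_add, real_inner_smul_left]
  ring_nf

theorem integrable_likelihoodRatio (t : ℝ) (d : ℂ) :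
    Integrable (likelihoodRatio t d) stdComplexGaussian := by
  simp_rw [funext (likelihoodRatio_eq t d)]
  exact (integrable_rexp_inner _).const_mul _

/-- The ratio is the density of a translated Gaussian with respect to the centred one. -/
theorem integral_likelihoodRatio (t : ℝ) (d : ℂ) :
    ∫ z, likelihoodRatio t d z ∂stdComplexGaussian = 1 := by
  simp_rw [likelihoodRatio_eq t d]
  rw [integral_const_mul, integral_rexp_inner, ← Real.exp_add, Real.exp_eq_one_iff, norm_smul,
    mul_pow, Real.norm_eq_abs, sq_abs]
  ring

theorem exists_likelihoodRatio_eq_exp {t : ℝ} (ht : t ≠ 0) {d : ℂ} (hd : d ≠ 0) (y : ℝ) :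
    ∃ z, likelihoodRatio t d z = Real.exp y := by
  have hd' : ‖d‖ ≠ 0 := norm_ne_zero_iff.2 hd
  refine ⟨((-y - t ^ 2 * ‖d‖ ^ 2) / (2 * t * ‖d‖ ^ 2)) • d, congrArg Real.exp ?_⟩
  rw [real_inner_smul_right, real_inner_self_eq_norm_sq]
  field_simp
  ring

/-- The ratio between the likelihood sums of two independent observations and of the first one. -/
noncomputable def likelihoodGain (X : Finset ℂ) (x : ℂ) (s t : ℝ) (p : ℂ × ℂ) : ℝ :=
  ∑ x' ∈ X, likelihoodRatio s (x - x') p.1 / likelihoodSum X x s p.1 *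
    likelihoodRatio t (x - x') p.2

theorem continuous_posterior (hx : x ∈ X) (s : ℝ) (d : ℂ) :
    Continuous fun z => likelihoodRatio s d z / likelihoodSum X x s z := by
  refine (continuous_likelihoodRatio s d).div₀ ?_ fun z =>
    (zero_lt_one.trans_le (one_le_likelihoodSum hx s z)).ne'
  unfold likelihoodSum
  fun_prop

theorem continuous_likelihoodGain (hx : x ∈ X) (s t : ℝ) :
    Continuous (likelihoodGain X x s t) :=
  continuous_finsetSum _ fun _ _ => ((continuous_posterior hx s _).comp continuous_fst).mul
    ((continuous_likelihoodRatio t _).comp continuous_snd)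

theorem likelihoodGain_pos (hx : x ∈ X) (s t : ℝ) (p : ℂ × ℂ) : 0 < likelihoodGain X x s t p :=
  Finset.sum_pos (fun _ _ => mul_pos (div_pos (likelihoodRatio_pos _ _ _)
    (zero_lt_one.trans_le (one_le_likelihoodSum hx s _))) (likelihoodRatio_pos _ _ _)) ⟨x, hx⟩

theorem integrable_posterior (hx : x ∈ X) (s : ℝ) {x' : ℂ} (hx' : x' ∈ X) :
    Integrable (fun z => likelihoodRatio s (x - x') z / likelihoodSum X x s z)
      stdComplexGaussian := by
  refine (integrable_const (1 : ℝ)).mono' (continuous_posterior hx s _).aestronglyMeasurable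
    (ae_of_all _ fun z => ?_)
  have h := zero_lt_one.trans_le (one_le_likelihoodSum hx s z)
  rw [Real.norm_of_nonneg (div_nonneg (likelihoodRatio_pos _ _ _).le h.le), div_le_one h,
    likelihoodSum_eq]
  exact Finset.single_le_sum (f := fun x' => likelihoodRatio s (x - x') z)
    (fun _ _ => (likelihoodRatio_pos _ _ _).le) hx'

theorem integrable_likelihoodGain (hx : x ∈ X) (s t : ℝ) :
    Integrable (likelihoodGain X x s t) (stdComplexGaussian.prod stdComplexGaussian) :=
  integrable_finsetSum _ fun _ hx' =>
    (integrable_posterior hx s hx').mul_prod (integrable_likelihoodRatio t _)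

/-- Integrating over the second observation replaces each ratio by `1`; the posterior weights left
from the first sum to `1`. -/
theorem integral_likelihoodGain (hx : x ∈ X) (s t : ℝ) :
    ∫ p, likelihoodGain X x s t p ∂(stdComplexGaussian.prod stdComplexGaussian) = 1 := by
  unfold likelihoodGain
  rw [integral_finsetSum _ fun x' hx' => (integrable_posterior hx s hx').mul_prod
    (integrable_likelihoodRatio t _)]
  have h (x' : ℂ) : ∫ p : ℂ × ℂ, likelihoodRatio s (x - x') p.1 / likelihoodSum X x s p.1 *
      likelihoodRatio t (x - x') p.2 ∂(stdComplexGaussian.prod stdComplexGaussian) =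
      ∫ z, likelihoodRatio s (x - x') z / likelihoodSum X x s z ∂stdComplexGaussian := by
    rw [integral_prod_mul (fun z => likelihoodRatio s (x - x') z / likelihoodSum X x s z),
      integral_likelihoodRatio, mul_one]
  simp_rw [h]
  rw [← integral_finsetSum _ fun x' hx' => integrable_posterior hx s hx']
  simp_rw [← Finset.sum_div, ← likelihoodSum_eq]
  simp [div_self (zero_lt_one.trans_le (one_le_likelihoodSum hx s _)).ne']

theorem exists_likelihoodGain_ne_one (hx : x ∈ X) (hX : 2 ≤ X.card) (s : ℝ) {t : ℝ} (ht : t ≠ 0) :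
    ∃ p, likelihoodGain X x s t p ≠ 1 := by
  obtain ⟨x', hx', hne⟩ := Finset.exists_mem_ne (by omega : 1 < X.card) x
  have hw : 0 < likelihoodRatio s (x - x') 0 / likelihoodSum X x s 0 :=
    div_pos (likelihoodRatio_pos _ _ _) (zero_lt_one.trans_le (one_le_likelihoodSum hx s _))
  set w := likelihoodRatio s (x - x') 0 / likelihoodSum X x s 0 with hw_def
  -- For this `z` the single term of `x'` already exceeds `1`, as `w * exp (w⁻¹) ≥ w + 1`.
  obtain ⟨z, hz⟩ := exists_likelihoodRatio_eq_exp ht (sub_ne_zero.2 hne.symm) w⁻¹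
  refine ⟨(0, z), ne_of_gt ?_⟩
  have h1 : w * likelihoodRatio t (x - x') z ≤ likelihoodGain X x s t (0, z) :=
    Finset.single_le_sum (f := fun x' => likelihoodRatio s (x - x') 0 / likelihoodSum X x s 0 *
      likelihoodRatio t (x - x') z) (fun _ _ => (mul_pos (div_pos (likelihoodRatio_pos _ _ _)
      (zero_lt_one.trans_le (one_le_likelihoodSum hx s _))) (likelihoodRatio_pos _ _ _)).le) hx'
  refine lt_of_lt_of_le ?_ h1
  rw [hz]
  have h2 := mul_le_mul_of_nonneg_left (Real.add_one_le_exp w⁻¹) hw.le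
  rw [mul_add, mul_inv_cancel₀ hw.ne'] at h2
  linarith

/-- Exponents add, so the joint likelihood sum sees the two noises only through `s z₁ + t z₂`, which
is distributed as `r z`. -/
theorem likelihoodSum_mul_gain (hx : x ∈ X) {s t r : ℝ} (h : s ^ 2 + t ^ 2 = r ^ 2) (p : ℂ × ℂ) :
    likelihoodSum X x s p.1 * likelihoodGain X x s t p =
      ∑ x' ∈ X, Real.exp (-(r ^ 2 * ‖x - x'‖ ^ 2 +
        2 * inner ℝ (x - x') (s • p.1 + t • p.2))) := by
  have h0 := (zero_lt_one.trans_le (one_le_likelihoodSum hx s p.1)).ne'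
  rw [likelihoodGain, Finset.mul_sum]
  refine Finset.sum_congr rfl fun x' _ => ?_
  rw [← mul_assoc, mul_div_cancel₀ _ h0, likelihoodRatio, likelihoodRatio, ← Real.exp_add,
    inner_add_right, real_inner_smul_right, real_inner_smul_right, ← h]
  ring_nf

theorem equivocation_lt (hx : x ∈ X) (hX : 2 ≤ X.card) {s t r : ℝ} (h : s ^ 2 + t ^ 2 = r ^ 2)
    (ht : t ≠ 0) : equivocation X x r < equivocation X x s := by
  set G := stdComplexGaussian
  -- `V` is the log-likelihood sum at amplitude `r` as a function of the scaled noise `y = r z`, so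
  -- that equality of the laws of `s z₁ + t z₂` and `r z` applies.
  set V : ℂ → ℝ := fun y => Real.log (∑ x' ∈ X,
    Real.exp (-(r ^ 2 * ‖x - x'‖ ^ 2 + 2 * inner ℝ (x - x') y))) with hV
  have hVc : Continuous V := by
    refine Continuous.log (by fun_prop) fun y => (Finset.sum_pos (fun _ _ => Real.exp_pos _)
      ⟨x, hx⟩).ne'
  have hVr (z : ℂ) : V (r • z) = Real.log (likelihoodSum X x r z) := by
    rw [hV, likelihoodSum_eq]
    refine congrArg Real.log (Finset.sum_congr rfl fun x' _ => ?_)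
    rw [likelihoodRatio, real_inner_smul_right, mul_assoc 2 r]
  have hm1 : Measurable fun p : ℂ × ℂ => s • p.1 + t • p.2 := by fun_prop
  have hm2 : Measurable fun z : ℂ => r • z := by fun_prop
  have hVi : Integrable (fun p : ℂ × ℂ => V (s • p.1 + t • p.2)) (G.prod G) := by
    have h1 : Integrable (fun z => V (r • z)) G :=
      (integrable_log_likelihoodSum hx r).congr (ae_of_all _ fun z => (hVr z).symm)
    have h2 := (integrable_map_measure hVc.aestronglyMeasurable hm2.aemeasurable).2 h1
    rw [← map_add_mul_prod_stdComplexGaussian h] at h2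
    exact (integrable_map_measure hVc.aestronglyMeasurable hm1.aemeasurable).1 h2
  have hVe : ∫ p, V (s • p.1 + t • p.2) ∂(G.prod G) = equivocation X x r := by
    rw [← integral_map (φ := fun p : ℂ × ℂ => s • p.1 + t • p.2) hm1.aemeasurable
      hVc.aestronglyMeasurable, map_add_mul_prod_stdComplexGaussian h,
      integral_map hm2.aemeasurable hVc.aestronglyMeasurable]
    simp_rw [hVr]
    rfl
  have hlog (p : ℂ × ℂ) : Real.log (likelihoodGain X x s t p) =
      V (s • p.1 + t • p.2) - Real.log (likelihoodSum X x s p.1) := by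
    simp only [hV]
    rw [← likelihoodSum_mul_gain hx h, Real.log_mul
      (zero_lt_one.trans_le (one_le_likelihoodSum hx s p.1)).ne' (likelihoodGain_pos hx s t p).ne']
    ring
  have hSi : Integrable (fun p : ℂ × ℂ => Real.log (likelihoodSum X x s p.1)) (G.prod G) :=
    (integrable_log_likelihoodSum hx s).comp_fst G
  have hSe : ∫ p : ℂ × ℂ, Real.log (likelihoodSum X x s p.1) ∂(G.prod G) = equivocation X x s := by
    rw [integral_fun_fst (fun z => Real.log (likelihoodSum X x s z))]
    simp [equivocation, G]
  have hli : Integrable (fun p => Real.log (likelihoodGain X x s t p)) (G.prod G) :=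
    (hVi.sub hSi).congr (ae_of_all _ fun p => (hlog p).symm)
  have hle : ∫ p, Real.log (likelihoodGain X x s t p) ∂(G.prod G) =
      equivocation X x r - equivocation X x s := by
    simp_rw [hlog]
    rw [integral_sub hVi hSi, hVe, hSe]
  have hgi := integrable_likelihoodGain hx s t
  have hgi1 : Integrable (fun p => likelihoodGain X x s t p - 1) (G.prod G) :=
    hgi.sub (integrable_const _)
  -- As the gain has mean `1`, the drop in equivocation is the mean of the nonnegative function `u -
  -- 1 - log u` at the gain `u`.
  have hint : ∫ p, (likelihoodGain X x s t p - 1 - Real.log (likelihoodGain X x s t p))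
      ∂(G.prod G) = equivocation X x s - equivocation X x r := by
    rw [integral_sub hgi1 hli, integral_sub hgi (integrable_const _), hle,
      integral_likelihoodGain hx]
    simp
  have hpos : 0 < ∫ p, (likelihoodGain X x s t p - 1 - Real.log (likelihoodGain X x s t p))
      ∂(G.prod G) := by
    have hc : Continuous fun p =>
        likelihoodGain X x s t p - 1 - Real.log (likelihoodGain X x s t p) :=
      ((continuous_likelihoodGain hx s t).sub continuous_const).sub
        ((continuous_likelihoodGain hx s t).log fun p => (likelihoodGain_pos hx s t p).ne')
    rw [integral_pos_iff_support_of_nonneg (fun p => sub_nonneg.2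
      (Real.log_le_sub_one_of_pos (likelihoodGain_pos hx s t p)))
      (hgi1.sub hli)]
    obtain ⟨p, hp⟩ := exists_likelihoodGain_ne_one hx hX s ht
    exact hc.isOpen_support.measure_pos _ ⟨p, (sub_pos.2
      (Real.log_lt_sub_one_of_pos (likelihoodGain_pos hx s t p) hp)).ne'⟩
  linarith

theorem equivocation_strictAntiOn (hx : x ∈ X) (hX : 2 ≤ X.card) :
    StrictAntiOn (equivocation X x) (Set.Ici 0) := by
  intro s hs r hr hsr
  have h : 0 < r ^ 2 - s ^ 2 := by
    rw [Set.mem_Ici] at hs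
    nlinarith
  exact equivocation_lt hx hX (t := √(r ^ 2 - s ^ 2)) (by rw [Real.sq_sqrt h.le]; ring)
    (Real.sqrt_pos.2 h).ne'

theorem mutualInfo_strictMonoOn (hX : 2 ≤ X.card) :
    StrictMonoOn (mutualInfo X) (Set.Ici 0) := by
  intro ρ hρ σ hσ h
  have hc : (0 : ℝ) < X.card := by exact_mod_cast (by omega : 0 < X.card)
  rw [mutualInfo_eq, mutualInfo_eq]
  refine sub_lt_sub_left (mul_lt_mul_of_pos_left ?_ (inv_pos.2 hc)) _
  refine Finset.sum_lt_sum_of_nonempty (Finset.card_pos.1 (by omega)) fun x hx => ?_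
  exact div_lt_div_of_pos_right (equivocation_strictAntiOn hx hX (Real.sqrt_nonneg _)
    (Real.sqrt_nonneg _) (Real.sqrt_lt_sqrt hρ h)) (Real.log_pos one_lt_two)

theorem mutualInfo_zero (hX : X.Nonempty) : mutualInfo X 0 = 0 := by
  have hc : (X.card : ℝ) ≠ 0 := by exact_mod_cast hX.card_pos.ne'
  simp [mutualInfo_eq, equivocation_zero, bits, Real.logb, hc]

theorem continuous_mutualInfo (X : Finset ℂ) : Continuous (mutualInfo X) := by
  simp_rw [funext (mutualInfo_eq X)]
  refine continuous_const.sub (continuous_const.mul (continuous_finsetSum _ fun x hx => ?_))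
  exact ((continuous_equivocation hx).comp Real.continuous_sqrt).div_const _

theorem tendsto_mutualInfo_atTop (X : Finset ℂ) : Tendsto (mutualInfo X) atTop (𝓝 (bits X)) := by
  simp_rw [funext (mutualInfo_eq X)]
  have h : Tendsto (fun ρ => ∑ x ∈ X, equivocation X x √ρ / Real.log 2) atTop
      (𝓝 (∑ _x ∈ X, 0 / Real.log 2)) :=
    tendsto_finsetSum _ fun x hx =>
      ((tendsto_equivocation_atTop hx).comp Real.tendsto_sqrt_atTop).div_const _
  simpa using (h.const_mul (X.card : ℝ)⁻¹).const_sub (bits X)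

theorem mutualInfo_le_bits (X : Finset ℂ) (ρ : ℝ) : mutualInfo X ρ ≤ bits X := by
  rw [mutualInfo_eq]
  refine sub_le_self _ (mul_nonneg (by positivity) (Finset.sum_nonneg fun x hx => ?_))
  exact div_nonneg (equivocation_nonneg hx _) (Real.log_nonneg one_le_two)

theorem mutualInfo_nonneg (hX : 2 ≤ X.card) {ρ : ℝ} (hρ : 0 ≤ ρ) : 0 ≤ mutualInfo X ρ := by
  rw [← mutualInfo_zero (Finset.card_pos.1 (by omega : 0 < X.card))]
  exact (mutualInfo_strictMonoOn hX).monotoneOn (Set.mem_Ici.2 le_rfl) hρ hρ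

theorem mutualInfo_pos (hX : 2 ≤ X.card) {ρ : ℝ} (hρ : 0 < ρ) : 0 < mutualInfo X ρ := by
  rw [← mutualInfo_zero (Finset.card_pos.1 (by omega : 0 < X.card))]
  exact mutualInfo_strictMonoOn hX (Set.mem_Ici.2 le_rfl) hρ.le hρ

theorem exists_mutualInfo_eq (hX : 2 ≤ X.card) {y : ℝ} (h0 : 0 ≤ y) (h1 : y < bits X) :
    ∃ ρ ∈ Set.Ici (0 : ℝ), mutualInfo X ρ = y := by
  obtain ⟨σ, hσ, hσ0⟩ := (((tendsto_mutualInfo_atTop X).eventually (lt_mem_nhds h1)).and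
    (eventually_ge_atTop 0)).exists
  obtain ⟨ρ, hρ, h⟩ := intermediate_value_Icc hσ0 (continuous_mutualInfo X).continuousOn
    (show y ∈ Set.Icc _ _ from
      ⟨(mutualInfo_zero (Finset.card_pos.1 (by omega : 0 < X.card))).trans_le h0, hσ.le⟩)
  exact ⟨ρ, hρ.1, h⟩

end Information

/-! ### The gamma law near zero -/

theorem setLIntegral_Ico_rpow {m : ℝ} (hm : 0 < m) {k x : ℝ} (hk : 0 ≤ k) (hx : 0 ≤ x) :
    ∫⁻ t in Set.Ico 0 x, ENNReal.ofReal (k * t ^ (m - 1)) = ENNReal.ofReal (k * (x ^ m / m)) := by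
  have hi : IntervalIntegrable (fun t : ℝ => k * t ^ (m - 1)) volume 0 x :=
    (intervalIntegral.intervalIntegrable_rpow' (by linarith)).const_mul k
  rw [← ofReal_integral_eq_lintegral_ofReal, integral_Ico_eq_integral_Ioc,
    ← intervalIntegral.integral_of_le hx, intervalIntegral.integral_const_mul,
    integral_rpow (Or.inl (by linarith)), sub_add_cancel, Real.zero_rpow hm.ne', sub_zero]
  · exact ((intervalIntegrable_iff_integrableOn_Ico_of_le hx).1 hi)
  · filter_upwards [ae_restrict_mem measurableSet_Ico] with t ht
    exact mul_nonneg hk (Real.rpow_nonneg ht.1 _)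

/-- The exponential factor of the density is at most `1`. -/
theorem exists_gammaMeasure_Iio_le {m : ℝ} (hm : 0 < m) :
    ∃ C : ℝ, 0 < C ∧ ∀ x : ℝ, 0 < x → (gammaMeasure m m).real (Set.Iio x) ≤ C * x ^ m := by
  have hk : 0 < m ^ m / Real.Gamma m :=
    div_pos (Real.rpow_pos_of_pos hm _) (Real.Gamma_pos_of_pos hm)
  refine ⟨m ^ m / Real.Gamma m / m, div_pos hk hm, fun x hx => ?_⟩
  refine ENNReal.toReal_le_of_le_ofReal (by positivity) ?_
  rw [gammaMeasure, withDensity_apply _ measurableSet_Iio]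
  calc ∫⁻ t in Set.Iio x, gammaPDF m m t
      ≤ ∫⁻ t in Set.Iio x, (Set.Ici 0).indicator
          (fun t => ENNReal.ofReal (m ^ m / Real.Gamma m * t ^ (m - 1))) t := by
        refine lintegral_mono fun t => ?_
        rcases lt_or_ge t 0 with ht | ht
        · simp [gammaPDF_of_neg ht]
        · rw [Set.indicator_of_mem (Set.mem_Ici.2 ht), gammaPDF_of_nonneg ht]
          refine ENNReal.ofReal_le_ofReal (mul_le_of_le_one_right
            (mul_nonneg hk.le (Real.rpow_nonneg ht _)) (Real.exp_le_one_iff.2 ?_))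
          nlinarith
    _ = ∫⁻ t in Set.Ico 0 x, ENNReal.ofReal (m ^ m / Real.Gamma m * t ^ (m - 1)) := by
        rw [lintegral_indicator measurableSet_Ici, Measure.restrict_restrict measurableSet_Ici,
          Set.Ici_inter_Iio]
    _ ≤ _ := by
        rw [setLIntegral_Ico_rpow hm hk.le hx.le]
        exact ENNReal.ofReal_le_ofReal (le_of_eq (by ring))

/-- On `[0, 1]` the exponential factor of the density is at least `exp (-m)`. -/
theorem exists_le_gammaMeasure_Iio {m : ℝ} (hm : 0 < m) :
    ∃ c : ℝ, 0 < c ∧ ∀ x : ℝ, 0 < x → x ≤ 1 → c * x ^ m ≤ (gammaMeasure m m).real (Set.Iio x) := by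
  have := isProbabilityMeasure_gammaMeasure hm hm
  have hk : 0 < m ^ m / Real.Gamma m :=
    div_pos (Real.rpow_pos_of_pos hm _) (Real.Gamma_pos_of_pos hm)
  refine ⟨m ^ m / Real.Gamma m * Real.exp (-m) / m, by positivity, fun x hx hx1 => ?_⟩
  refine (ENNReal.ofReal_le_iff_le_toReal (measure_ne_top _ _)).1 ?_
  rw [gammaMeasure, withDensity_apply _ measurableSet_Iio]
  calc ENNReal.ofReal (m ^ m / Real.Gamma m * Real.exp (-m) / m * x ^ m)
      = ∫⁻ t in Set.Ico 0 x, ENNReal.ofReal (m ^ m / Real.Gamma m * Real.exp (-m) * t ^ (m - 1)) := by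
        rw [setLIntegral_Ico_rpow hm (by positivity) hx.le, mul_div_assoc', div_mul_eq_mul_div]
    _ ≤ ∫⁻ t in Set.Ico 0 x, gammaPDF m m t := by
        refine setLIntegral_mono' measurableSet_Ico fun t ht => ?_
        rw [gammaPDF_of_nonneg ht.1, mul_right_comm]
        refine ENNReal.ofReal_le_ofReal (mul_le_mul_of_nonneg_left (Real.exp_le_exp.2 ?_)
          (mul_nonneg hk.le (Real.rpow_nonneg ht.1 _)))
        nlinarith [ht.2]
    _ ≤ ∫⁻ t in Set.Iio x, gammaPDF m m t := lintegral_mono_set Set.Ico_subset_Iio_self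

theorem ae_pos_gammaMeasure (a r : ℝ) : ∀ᵐ x ∂(gammaMeasure a r), 0 < x := by
  have h : {x : ℝ | ¬ 0 < x} = Set.Iic 0 := by ext; simp
  rw [ae_iff, h, gammaMeasure, withDensity_apply _ measurableSet_Iic,
    ← setLIntegral_congr Iio_ae_eq_Iic, lintegral_gammaPDF_of_nonpos le_rfl]

/-! ### The allocation rule -/

section Allocation

variable {B : ℕ} {β P : ℝ} {γ : Fin B → ℝ}

theorem sum_twPower_epsilon (hβ : 0 < β) (hP : 0 ≤ P) (hγ : ∀ b, 0 < γ b)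
    (h : ¬ ∑ b, β / γ b ≤ B * P) :
    ∑ b, twPower β (Classical.epsilon fun η => ∑ c, twPower β η (γ c) = B * P) (γ b) = B * P :=
  Classical.epsilon_spec (exists_waterLevel hβ hP hγ h)

theorem twPower_nonneg (hβ : 0 < β) (η : ℝ) {g : ℝ} (hg : 0 < g) : 0 ≤ twPower β η g :=
  le_min (div_pos hβ hg).le (le_max_right _ _)

theorem twAlloc_nonneg (hβ : 0 < β) (P : ℝ) (hγ : ∀ b, 0 < γ b) (b : Fin B) :
    0 ≤ twAlloc β P γ b := by
  unfold twAlloc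
  split_ifs
  · exact (div_pos hβ (hγ b)).le
  · exact twPower_nonneg hβ _ (hγ b)

theorem twAlloc_le (hβ : 0 < β) (hP : 0 ≤ P) (hγ : ∀ b, 0 < γ b) (b : Fin B) :
    twAlloc β P γ b ≤ B * P := by
  unfold twAlloc
  split_ifs with h
  · exact (Finset.single_le_sum (f := fun c => β / γ c) (fun c _ => (div_pos hβ (hγ c)).le)
      (Finset.mem_univ b)).trans h
  · refine le_trans ?_ (sum_twPower_epsilon hβ hP hγ h).le
    exact Finset.single_le_sum (f := fun c => twPower β _ (γ c))
      (fun c _ => twPower_nonneg hβ _ (hγ c)) (Finset.mem_univ b)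

/-- When the budget binds, the water level is at least `P`; then `(β + 1) / γ b ≤ P ≤ η` says that
the cap `β / γ b` is the smaller term. -/
theorem twAlloc_mul_eq (hβ : 0 < β) (hP : 0 < P) (hγ : ∀ b, 0 < γ b) {b : Fin B}
    (hb : (β + 1) / P ≤ γ b) : twAlloc β P γ b * γ b = β := by
  unfold twAlloc
  split_ifs with h
  · exact div_mul_cancel₀ _ (hγ b).ne'
  · have hs := sum_twPower_epsilon hβ hP.le hγ h
    set η := Classical.epsilon fun η => ∑ c, twPower β η (γ c) = B * P
    -- The `B` powers sum to `B * P`, so one of them is at least the average `P`.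
    obtain ⟨c, -, hc⟩ : ∃ c ∈ Finset.univ, P ≤ twPower β η (γ c) :=
      Finset.exists_le_of_sum_le (f := fun _ => P) ⟨b, Finset.mem_univ b⟩ (by simp [hs])
    have hη : P ≤ η := by
      rcases le_max_iff.1 (hc.trans (min_le_right _ _)) with h1 | h1
      · linarith [one_div_pos.2 (hγ c)]
      · linarith
    have h2 : β / γ b ≤ η - 1 / γ b := by
      rw [le_sub_iff_add_le, ← add_div]
      exact ((div_le_comm₀ hP (hγ b)).1 hb).trans hη
    rw [twPower, min_eq_left (h2.trans (le_max_left _ _))]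
    exact div_mul_cancel₀ _ (hγ b).ne'

variable {X : Finset ℂ} {R : ℝ}

/-- Every block that is not weak contributes `I_𝒳(β)` and the others at least `0`, so outage leaves
fewer than `B R / I_𝒳(β)` such blocks. -/
theorem twDiversity_le_card (hX : 2 ≤ X.card) (hB : 1 ≤ B) (hβ : 0 < β) (hP : 0 < P)
    (hγ : ∀ b, 0 < γ b) (hR : blockMutualInfo X (twAlloc β P γ) γ < R) :
    twDiversity X B β R ≤ (Finset.univ.filter fun b => γ b < (β + 1) / P).card := by
  have hI := mutualInfo_pos hX hβ
  have hB' : (0 : ℝ) < B := by exact_mod_cast hB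
  have hcard : (Finset.univ.filter fun b => γ b < (β + 1) / P).card +
      (Finset.univ.filter fun b => ¬ γ b < (β + 1) / P).card = B := by
    simpa using Finset.card_filter_add_card_filter_not (s := Finset.univ)
      (fun b => γ b < (β + 1) / P)
  have hcard' : ((Finset.univ.filter fun b => γ b < (β + 1) / P).card : ℝ) +
      (Finset.univ.filter fun b => ¬ γ b < (β + 1) / P).card = B := by exact_mod_cast hcard
  have hle : (Finset.univ.filter fun b => ¬ γ b < (β + 1) / P).card * mutualInfo X β ≤
      ∑ b, mutualInfo X (twAlloc β P γ b * γ b) := by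
    rw [← nsmul_eq_mul, ← Finset.sum_const]
    refine le_trans (Finset.sum_le_sum fun b hb => ?_)
      (Finset.sum_le_sum_of_subset_of_nonneg (Finset.filter_subset _ _) fun b _ _ =>
        mutualInfo_nonneg hX (mul_nonneg (twAlloc_nonneg hβ P hγ b) (hγ b).le))
    rw [twAlloc_mul_eq hβ hP hγ (not_lt.1 (Finset.mem_filter.1 hb).2)]
  rw [blockMutualInfo, inv_mul_lt_iff₀ hB'] at hR
  have h1 : ((Finset.univ.filter fun b => ¬ γ b < (β + 1) / P).card : ℝ) <
      B * R / mutualInfo X β := by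
    rw [lt_div_iff₀ hI]
    exact hle.trans_lt hR
  rw [twDiversity, add_comm, Int.add_one_le_iff, Int.floor_lt]
  push_cast
  rw [mul_sub, mul_one, mul_div_assoc']
  linarith

end Allocation

/-! ### Outage probability -/

section Outage

variable {Ω : Type*} [MeasurableSpace Ω] {μ : Measure Ω}
  {X : Finset ℂ} {B : ℕ} {m : ℝ} {γ : Fin B → Ω → ℝ}

theorem measureReal_iInter_Iio (hindep : iIndepFun γ μ)
    (hlaw : ∀ b, HasLaw (γ b) (gammaMeasure m m) μ) (S : Finset (Fin B)) (x : ℝ) :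
    μ.real (⋂ b ∈ S, γ b ⁻¹' Set.Iio x) = (gammaMeasure m m).real (Set.Iio x) ^ S.card := by
  rw [Measure.real, hindep.measure_inter_preimage_eq_mul S fun _ _ => measurableSet_Iio,
    ENNReal.toReal_prod, ← Finset.prod_const]
  exact Finset.prod_congr rfl fun b _ => (hlaw b).measureReal_eq (p := (· < x)) measurableSet_Iio

theorem ae_forall_pos (hlaw : ∀ b, HasLaw (γ b) (gammaMeasure m m) μ) :
    ∀ᵐ ω ∂μ, ∀ b, 0 < γ b ω := by
  refine ae_all_iff.2 fun b => ?_
  have h := ae_pos_gammaMeasure m m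
  rw [← (hlaw b).map_eq] at h
  exact ae_of_ae_map (hlaw b).aemeasurable h

theorem rpow_div_pow {P m a C : ℝ} (hP : 0 < P) (ha : 0 ≤ a) (n : ℕ) :
    (C * (a / P) ^ m) ^ n = (C * a ^ m) ^ n * P ^ (-(m * n)) := by
  rw [Real.div_rpow ha hP.le, mul_div_assoc', div_pow, Real.rpow_neg hP.le, Real.rpow_mul hP.le,
    Real.rpow_natCast, div_eq_mul_inv]

theorem exists_outageProb_le [IsProbabilityMeasure μ] (hX : 2 ≤ X.card) (hB : 1 ≤ B) (hm : 0 < m)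
    (hindep : iIndepFun γ μ)
    (hlaw : ∀ b, HasLaw (γ b) (gammaMeasure m m) μ) {β : ℝ} (hβ : 0 < β) (R : ℝ) :
    ∃ K : ℝ, 0 < K ∧ ∀ᶠ P : ℝ in atTop,
      outageProb μ X γ (twAlloc β P) R ≤ K * P ^ (-(m * (twDiversity X B β R : ℝ))) := by
  -- A nonpositive exponent `d_β(R)` makes the bound at least `1` for `P ≥ 1`.
  rcases le_or_gt (twDiversity X B β R) 0 with hd | hd
  · refine ⟨1, one_pos, (eventually_ge_atTop 1).mono fun P hP => ?_⟩
    rw [one_mul]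
    refine measureReal_le_one.trans (Real.one_le_rpow hP ?_)
    have : (twDiversity X B β R : ℝ) ≤ 0 := by exact_mod_cast hd
    nlinarith
  obtain ⟨n, hn⟩ := Int.eq_ofNat_of_zero_le hd.le
  obtain ⟨C, hC, hCle⟩ := exists_gammaMeasure_Iio_le hm
  -- The binomial coefficient counts the sets of `n` weak blocks; the added `1` keeps the constant
  -- positive even if `n > B`.
  refine ⟨(B.choose n : ℝ) * (C * (β + 1) ^ m) ^ n + 1, by positivity,
    (eventually_gt_atTop 0).mono fun P hP => ?_⟩
  have hsub : {ω | blockMutualInfo X (twAlloc β P fun b => γ b ω) (fun b => γ b ω) < R} ≤ᵐ[μ]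
      ⋃ S ∈ Finset.univ.powersetCard n, ⋂ b ∈ S, γ b ⁻¹' Set.Iio ((β + 1) / P) := by
    filter_upwards [ae_forall_pos hlaw] with ω hω hR
    have h := twDiversity_le_card hX hB hβ hP hω hR
    rw [hn, Nat.cast_le] at h
    obtain ⟨S, hS, hSn⟩ := Finset.exists_subset_card_eq h
    refine Set.mem_iUnion₂.2 ⟨S, Finset.mem_powersetCard.2 ⟨Finset.subset_univ _, hSn⟩,
      Set.mem_iInter₂.2 fun b hb => (Finset.mem_filter.1 (hS hb)).2⟩
  calc outageProb μ X γ (twAlloc β P) R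
      ≤ μ.real (⋃ S ∈ Finset.univ.powersetCard n, ⋂ b ∈ S, γ b ⁻¹' Set.Iio ((β + 1) / P)) :=
        ENNReal.toReal_mono (measure_ne_top _ _) (measure_mono_ae hsub)
    _ ≤ ∑ S ∈ Finset.univ.powersetCard n, μ.real (⋂ b ∈ S, γ b ⁻¹' Set.Iio ((β + 1) / P)) :=
        measureReal_biUnion_finset_le _ _
    _ ≤ ∑ _S ∈ Finset.univ.powersetCard n, (C * ((β + 1) / P) ^ m) ^ n := by
        refine Finset.sum_le_sum fun S hS => ?_
        rw [measureReal_iInter_Iio hindep hlaw, (Finset.mem_powersetCard.1 hS).2]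
        exact pow_le_pow_left₀ measureReal_nonneg (hCle _ (by positivity)) _
    _ = (B.choose n : ℝ) * (C * (β + 1) ^ m) ^ n * P ^ (-(m * n)) := by
        rw [Finset.sum_const, Finset.card_powersetCard, Finset.card_univ, Fintype.card_fin,
          nsmul_eq_mul, rpow_div_pow hP (by positivity), mul_assoc]
    _ ≤ _ := by
        rw [hn, Int.cast_natCast]
        gcongr
        linarith

variable {R : ℝ}

/-- A power of at most `B * P` keeps the SNR on `S` below `ε`. The bound in `hε` is an equal share
of what `B R` leaves after granting `M` to every block outside `S`. -/
theorem blockMutualInfo_lt (hB : 1 ≤ B) {β P ε n : ℝ} (hβ : 0 < β) (hP : 0 < P)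
    {g : Fin B → ℝ} (hg : ∀ b, 0 < g b) {S : Finset (Fin B)} (hS : S.Nonempty) (hn : n = S.card)
    (hε : ∀ ρ, 0 ≤ ρ → ρ < ε → mutualInfo X ρ < (B * R - (B - n) * bits X) / n)
    (hgS : ∀ b ∈ S, g b < ε / B / P) : blockMutualInfo X (twAlloc β P g) g < R := by
  have hB' : (0 : ℝ) < B := by exact_mod_cast hB
  have hn0 : 0 < n := by rw [hn]; exact_mod_cast hS.card_pos
  rw [blockMutualInfo, inv_mul_lt_iff₀ hB', ← Finset.sum_add_sum_compl S]
  have h1 : ∑ b ∈ S, mutualInfo X (twAlloc β P g b * g b) < B * R - (B - n) * bits X := by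
    have h2 : ∑ _b ∈ S, (B * R - (B - n) * bits X) / n = B * R - (B - n) * bits X := by
      rw [Finset.sum_const, nsmul_eq_mul, ← hn, mul_div_cancel₀ _ hn0.ne']
    rw [← h2]
    refine Finset.sum_lt_sum_of_nonempty hS fun b hb =>
      hε _ (mul_nonneg (twAlloc_nonneg hβ P hg b) (hg b).le) ?_
    calc twAlloc β P g b * g b ≤ B * P * g b :=
          mul_le_mul_of_nonneg_right (twAlloc_le hβ hP.le hg b) (hg b).le
      _ < B * P * (ε / B / P) := mul_lt_mul_of_pos_left (hgS b hb) (by positivity)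
      _ = ε := by field_simp
  have h2 : ∑ b ∈ Sᶜ, mutualInfo X (twAlloc β P g b * g b) ≤ (B - n) * bits X := by
    refine (Finset.sum_le_card_nsmul _ _ _ fun b _ => mutualInfo_le_bits X _).trans_eq ?_
    rw [nsmul_eq_mul, Finset.card_compl, Fintype.card_fin,
      Nat.cast_sub (by simpa using Finset.card_le_univ S), hn]
  linarith

theorem bits_pos (hX : 2 ≤ X.card) : 0 < bits X :=
  Real.logb_pos one_lt_two (by exact_mod_cast (by omega : 1 < X.card))

theorem exists_singletonBound_eq (hB : 1 ≤ B) (hR0 : 0 < R) (hR : R < bits X) :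
    ∃ n : ℕ, singletonBound X B R = n ∧ 1 ≤ n ∧ n ≤ B := by
  have hB' : (0 : ℝ) < B := by exact_mod_cast hB
  have hM := hR0.trans hR
  have h1 : 0 ≤ ⌊(B : ℝ) * (1 - R / bits X)⌋ := Int.floor_nonneg.2
    (mul_nonneg hB'.le (sub_nonneg.2 ((div_le_one hM).2 hR.le)))
  have h2 : ⌊(B : ℝ) * (1 - R / bits X)⌋ < (B : ℤ) := by
    rw [Int.floor_lt, Int.cast_natCast]
    exact mul_lt_of_lt_one_right hB' (by linarith [div_pos hR0 hM])
  refine ⟨(singletonBound X B R).toNat, ?_, ?_, ?_⟩ <;> unfold singletonBound <;> omega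

theorem exists_le_outageProb [IsProbabilityMeasure μ] (hX : 2 ≤ X.card) (hB : 1 ≤ B) (hm : 0 < m)
    (hindep : iIndepFun γ μ)
    (hlaw : ∀ b, HasLaw (γ b) (gammaMeasure m m) μ) {β : ℝ} (hβ : 0 < β) (hR0 : 0 < R)
    (hR : R < bits X) :
    ∃ c : ℝ, 0 < c ∧ ∀ᶠ P : ℝ in atTop,
      c * P ^ (-(m * (singletonBound X B R : ℝ))) ≤ outageProb μ X γ (twAlloc β P) R := by
  obtain ⟨n, hn, hn1, hnB⟩ := exists_singletonBound_eq hB hR0 hR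
  have hM := hR0.trans hR
  have hB' : (0 : ℝ) < B := by exact_mod_cast hB
  have hn0 : (0 : ℝ) < n := by exact_mod_cast hn1
  -- Since `n` is one more than the floor, `n > B (1 - R / M)` strictly, that is `(B - n) M < B R`.
  have hgap : 0 < (B * R - (B - n) * bits X) / n := by
    refine div_pos ?_ hn0
    have h1 := Int.lt_floor_add_one ((B : ℝ) * (1 - R / bits X))
    have h2 : (⌊(B : ℝ) * (1 - R / bits X)⌋ : ℝ) + 1 = n := by
      rw [add_comm]; unfold singletonBound at hn; exact_mod_cast hn
    rw [h2] at h1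
    have h3 := mul_lt_mul_of_pos_right h1 hM
    have h4 : (B : ℝ) * (1 - R / bits X) * bits X = B * bits X - B * R := by
      field_simp
    linarith
  obtain ⟨ε, hε, hεI⟩ : ∃ ε : ℝ, 0 < ε ∧ ∀ ρ, 0 ≤ ρ → ρ < ε →
      mutualInfo X ρ < (B * R - (B - n) * bits X) / n := by
    have h := (continuous_mutualInfo X).tendsto 0
    rw [mutualInfo_zero (Finset.card_pos.1 (by omega))] at h
    obtain ⟨ε, hε, h⟩ := Metric.eventually_nhds_iff.1 (h.eventually (gt_mem_nhds hgap))
    exact ⟨ε, hε, fun ρ h0 h1 => h (by rwa [Real.dist_eq, sub_zero, abs_of_nonneg h0])⟩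
  obtain ⟨c, hc, hcle⟩ := exists_le_gammaMeasure_Iio hm
  obtain ⟨S, -, hS⟩ := Finset.exists_subset_card_eq (s := (Finset.univ : Finset (Fin B)))
    (by simpa using hnB)
  refine ⟨(c * (ε / B) ^ m) ^ n, by positivity, ?_⟩
  filter_upwards [eventually_gt_atTop 0, eventually_ge_atTop (ε / B)] with P hP hP1
  rw [hn, Int.cast_natCast, ← rpow_div_pow hP (by positivity)]
  calc (c * (ε / B / P) ^ m) ^ n ≤ (gammaMeasure m m).real (Set.Iio (ε / B / P)) ^ n :=
        pow_le_pow_left₀ (by positivity) (hcle _ (by positivity) ((div_le_one hP).2 hP1)) _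
    _ = μ.real (⋂ b ∈ S, γ b ⁻¹' Set.Iio (ε / B / P)) := by
        rw [measureReal_iInter_Iio hindep hlaw, hS]
    _ ≤ outageProb μ X γ (twAlloc β P) R := by
        refine ENNReal.toReal_mono (measure_ne_top _ _) (measure_mono_ae ?_)
        filter_upwards [ae_forall_pos hlaw] with ω hω h
        exact blockMutualInfo_lt hB hβ hP hω (Finset.card_pos.1 (by omega)) (by rw [hS]) hεI
          fun b hb => Set.mem_iInter₂.1 h b hb

/-! ### The truncation threshold -/

/-- Non-integrality makes the floor strict. At an integer the threshold would equal `M`, which `I_𝒳`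
only approaches. -/
theorem rateThreshold_mem (hX : 2 ≤ X.card) (hB : 1 ≤ B) (hR0 : 0 < R)
    (hint : ∀ k : ℤ, (B : ℝ) * (1 - R / bits X) ≠ k) :
    rateThreshold X B R ∈ Set.Ioo 0 (bits X) := by
  have hB' : (0 : ℝ) < B := by exact_mod_cast hB
  have hM := bits_pos hX
  have h1 : (⌊(B : ℝ) * (1 - R / bits X)⌋ : ℝ) < B * (1 - R / bits X) :=
    lt_of_le_of_ne (Int.floor_le _) (hint _).symm
  have h2 : B * R / bits X < B - ⌊(B : ℝ) * (1 - R / bits X)⌋ := by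
    rw [mul_div_assoc]; linarith
  have h3 : 0 < B * R / bits X := by positivity
  exact ⟨div_pos (by positivity) (h3.trans h2), (div_lt_comm₀ hM (h3.trans h2)).1 h2⟩

theorem betaThreshold_spec (hX : 2 ≤ X.card) (h : rateThreshold X B R ∈ Set.Ioo 0 (bits X)) :
    0 < betaThreshold X B R ∧ mutualInfo X (betaThreshold X B R) = rateThreshold X B R := by
  have hex := exists_mutualInfo_eq hX h.1.le h.2
  have h0 : betaThreshold X B R ∈ Set.Ici 0 := Function.invFunOn_mem hex
  have h1 : mutualInfo X (betaThreshold X B R) = rateThreshold X B R := Function.invFunOn_eq hex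
  refine ⟨lt_of_le_of_ne h0 fun h2 => ?_, h1⟩
  rw [← h2, mutualInfo_zero (Finset.card_pos.1 (by omega))] at h1
  exact h.1.ne h1

/-- `I_𝒳(β) ≥ I_𝒳(β_R)` rearranges to `⌊B (1 - R / M)⌋ ≤ B (1 - R / I_𝒳(β))`, while `I_𝒳(β) ≤ M`
gives the other inequality of floors. -/
theorem twDiversity_eq_singletonBound (hX : 2 ≤ X.card) (hB : 1 ≤ B) (hR0 : 0 < R)
    (h : rateThreshold X B R ∈ Set.Ioo 0 (bits X)) {β : ℝ} (hβ : betaThreshold X B R ≤ β) :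
    twDiversity X B β R = singletonBound X B R := by
  have hB' : (0 : ℝ) < B := by exact_mod_cast hB
  obtain ⟨h0, h1⟩ := betaThreshold_spec hX h
  have h2 : rateThreshold X B R ≤ mutualInfo X β := by
    rw [← h1]
    exact (mutualInfo_strictMonoOn hX).monotoneOn h0.le (h0.le.trans hβ) hβ
  have h3 := h.1.trans_le h2
  have h4 : (0 : ℝ) < B - ⌊(B : ℝ) * (1 - R / bits X)⌋ := by
    by_contra h5
    exact h.1.not_ge (div_nonpos_of_nonneg_of_nonpos (by positivity) (not_lt.1 h5))
  rw [twDiversity, singletonBound, add_right_inj, Int.floor_eq_iff]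
  constructor
  · have h5 := (div_le_comm₀ h4 h3).1 h2
    have h6 : (B : ℝ) * (1 - R / mutualInfo X β) = B - B * R / mutualInfo X β := by ring
    linarith
  · refine lt_of_le_of_lt ?_ (Int.lt_floor_add_one _)
    gcongr
    exact mutualInfo_le_bits X β

theorem tendsto_neg_log_div_log {f : ℝ → ℝ} {c K a : ℝ} (hc : 0 < c) (hK : 0 < K)
    (h : ∀ᶠ P in atTop, c * P ^ (-a) ≤ f P ∧ f P ≤ K * P ^ (-a)) :
    Tendsto (fun P => -Real.log (f P) / Real.log P) atTop (𝓝 a) := by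
  have hlim (k : ℝ) : Tendsto (fun P => -Real.log k / Real.log P + a) atTop (𝓝 a) := by
    simpa using (Real.tendsto_log_atTop.const_div_atTop (-Real.log k)).add_const a
  have heq {k P : ℝ} (hk : 0 < k) (hP : 1 < P) :
      -Real.log k / Real.log P + a = -Real.log (k * P ^ (-a)) / Real.log P := by
    have h0 : 0 < P := zero_lt_one.trans hP
    have := (Real.log_pos hP).ne'
    rw [Real.log_mul hk.ne' (Real.rpow_pos_of_pos h0 _).ne', Real.log_rpow h0]
    field_simp
    ring
  -- Negating the logarithm swaps the roles: `K` gives the lower bound and `c` the upper one.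
  refine tendsto_of_tendsto_of_tendsto_of_le_of_le' (hlim K) (hlim c) ?_ ?_
  · filter_upwards [h, eventually_gt_atTop 1] with P hf hP
    have h0 : 0 < P := zero_lt_one.trans hP
    rw [heq hK hP]
    exact div_le_div_of_nonneg_right (neg_le_neg (Real.log_le_log
      ((mul_pos hc (Real.rpow_pos_of_pos h0 _)).trans_le hf.1) hf.2)) (Real.log_pos hP).le
  · filter_upwards [h, eventually_gt_atTop 1] with P hf hP
    have h0 : 0 < P := zero_lt_one.trans hP
    rw [heq hc hP]
    exact div_le_div_of_nonneg_right (neg_le_neg (Real.log_le_log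
      (mul_pos hc (Real.rpow_pos_of_pos h0 _)) hf.1)) (Real.log_pos hP).le

end Outage

end BlockFading

theorem mainTheorem3 {Ω : Type*} [MeasurableSpace Ω] (μ : MeasureTheory.Measure Ω)
    [MeasureTheory.IsProbabilityMeasure μ]
    (X : Finset ℂ) (hcard : 2 ≤ X.card) (henergy : ∑ x ∈ X, ‖x‖ ^ 2 = (X.card : ℝ))
    (B : ℕ) (hB : 1 ≤ B) (m : ℝ) (hm : 0 < m)
    (γ : Fin B → Ω → ℝ) (hindep : ProbabilityTheory.iIndepFun γ μ)
    (hlaw : ∀ b, ProbabilityTheory.HasLaw (γ b) (ProbabilityTheory.gammaMeasure m m) μ) :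
    (∀ β : ℝ, 0 < β → ∀ R : ℝ, 0 < R →
      ∃ K : ℝ, 0 < K ∧ ∀ᶠ P : ℝ in Filter.atTop,
        BlockFading.outageProb μ X γ (BlockFading.twAlloc β P) R ≤
          K * P ^ (-(m * (BlockFading.twDiversity X B β R : ℝ)))) ∧
    (∀ R : ℝ, 0 < R → R < BlockFading.bits X →
      (∀ k : ℤ, (B : ℝ) * (1 - R / BlockFading.bits X) ≠ k) →
      (∀ ρ : ℝ, 0 ≤ ρ →
        (BlockFading.mutualInfo X ρ = BlockFading.rateThreshold X B R ↔
          ρ = BlockFading.betaThreshold X B R)) ∧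
      0 < BlockFading.betaThreshold X B R ∧
      ∀ β : ℝ, BlockFading.betaThreshold X B R ≤ β →
        BlockFading.twDiversity X B β R = BlockFading.singletonBound X B R ∧
        (∃ c K : ℝ, 0 < c ∧ 0 < K ∧ ∀ᶠ P : ℝ in Filter.atTop,
          c * P ^ (-(m * (BlockFading.singletonBound X B R : ℝ))) ≤
            BlockFading.outageProb μ X γ (BlockFading.twAlloc β P) R ∧
          BlockFading.outageProb μ X γ (BlockFading.twAlloc β P) R ≤
            K * P ^ (-(m * (BlockFading.singletonBound X B R : ℝ)))) ∧
        Filter.Tendsto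
          (fun P : ℝ => -Real.log (BlockFading.outageProb μ X γ (BlockFading.twAlloc β P) R) /
            Real.log P)
          Filter.atTop (nhds (m * (BlockFading.singletonBound X B R : ℝ)))) := by
  refine ⟨fun β hβ R _ => BlockFading.exists_outageProb_le hcard hB hm hindep hlaw hβ R,
    fun R hR0 hR hint => ?_⟩
  have hmem := BlockFading.rateThreshold_mem hcard hB hR0 hint
  obtain ⟨hpos, heq⟩ := BlockFading.betaThreshold_spec hcard hmem
  refine ⟨fun ρ hρ => ⟨fun h => ?_, fun h => h ▸ heq⟩, hpos, fun β hβ => ?_⟩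
  · exact (BlockFading.mutualInfo_strictMonoOn hcard).injOn hρ hpos.le (h.trans heq.symm)
  have hd := BlockFading.twDiversity_eq_singletonBound hcard hB hR0 hmem hβ
  have hβ0 := hpos.trans_le hβ
  obtain ⟨K, hK, hKle⟩ := BlockFading.exists_outageProb_le hcard hB hm hindep hlaw hβ0 R
  obtain ⟨c, hc, hcle⟩ := BlockFading.exists_le_outageProb hcard hB hm hindep hlaw hβ0 hR0 hR
  rw [hd] at hKle
  have hboth := hcle.and hKle
  exact ⟨hd, ⟨c, K, hc, hK, hboth⟩, BlockFading.tendsto_neg_log_div_log hc hK hboth⟩
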